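/- Let $n$ and $t$ be non-negative integers with $n \ge 2t+1$, and let $S_n$ be the group of permutations of $[n]=\{1,\dots,n\}$. Let $\mathcal{F}\subseteq S_n$ be a $t$-cycle-intersecting family, that is, any two distinct permutations in $\mathcal{F}$, when written in cycle decomposition form (with cycles of length one included), have at least $t$ cycles in common. Then $$|\mathcal{F}| \le (n-t)!,$$ and equality holds if and only if $\mathcal{F}$ is the stabilizer of $t$ points, that is, there is a set $T\subseteq[n]$ with $|T|=t$ such that $\mathcal{F}=\{\sigma\in S_n : \sigma(i)=i \text{ for all } i\in T\}$. -/

import Mathlib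

/-- The set of cycles in the cycle decomposition of `σ`, cycles of length one included.
A cycle of length one is recorded by its point (`Sum.inl x` with `σ x = x`); a cycle of length
at least two is recorded as a cyclic permutation (`Sum.inr c` with `c ∈ σ.cycleFactorsFinset`). -/
def permCycles {n : ℕ} (σ : Equiv.Perm (Fin n)) : Finset (Fin n ⊕ Equiv.Perm (Fin n)) :=
  (Finset.univ.filter fun x => σ x = x).disjSum σ.cycleFactorsFinset

/-- Any two (distinct) members of the family have at least `t` cycles in common. -/
def IsCycleIntersecting {n : ℕ} (t : ℕ) (F : Finset (Equiv.Perm (Fin n))) : Prop :=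
  ∀ σ ∈ F, ∀ π ∈ F, σ ≠ π → t ≤ (permCycles σ ∩ permCycles π).card

/-- The family consists of exactly those permutations that fix each of some `t` points. -/
def IsStabilizerOfPoints {n : ℕ} (t : ℕ) (F : Finset (Equiv.Perm (Fin n))) : Prop :=
  ∃ T : Finset (Fin n), T.card = t ∧ ∀ σ : Equiv.Perm (Fin n), σ ∈ F ↔ ∀ i ∈ T, σ i = i

/-! The proof compresses permutations until cycles in common become fixed points in common, and then
solves a weighted intersection problem for sets of fixed points.

If `σ i = j ≠ i`, then `swap i j * σ` detaches `i` from its cycle and makes it a fixed point. Doing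
this throughout `F`, except where the result already lies in `F`, preserves `#F` and the
intersection property (`IsCycleIntersecting.image_detachCompress`) and shrinks supports, so it
terminates. In a family stable under all detachments, any two members, equal ones included, share
`t` fixed points (`le_card_common_fixed`): common nontrivial cycles can be broken one by one without
creating a common fixed point.

The fixed-point sets then form a `t`-intersecting family, and a set missing `b` points is the
fixed-point set of `numDerangements b` permutations. If it contains a `t`-set `T`, every member of
`F` fixes `T`. Otherwise `sum_partialDerangements_lt` makes the total weight strictly less than `(n
- t)!`. Its proof removes the last ground point and turns it into a free point, one that may be
fixed or moved; `partialDerangements x b` is the weight with `x` free points. After left-shifting,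
conflicts occur only between complementary layers, and they are resolved by discarding sets without
losing weight.

Equality thus forces a stabilizer in the stable case, and
`IsStabilizerOfPoints.of_image_detachCompress` carries this back through each compression. -/

/-! ### Derangement weights with free points. -/

/-- The number of permutations of `x + b` points that move each of `b` given points. -/
def partialDerangements : ℕ → ℕ → ℕ
  | 0, b => numDerangements b
  | x + 1, b => partialDerangements x (b + 1) + partialDerangements x b

theorem partialDerangements_zero (b : ℕ) : partialDerangements 0 b = numDerangements b := rfl

theorem partialDerangements_succ (x b : ℕ) : partialDerangements (x + 1) b =
    partialDerangements x (b + 1) + partialDerangements x b := rfl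

/-- The derangement recurrence survives the addition of free points, because the Pascal-type rule
`partialDerangements_succ` propagates it from `x` to `x + 1`. -/
theorem partialDerangements_add_two (x b : ℕ) : partialDerangements x (b + 2) =
    (x + b + 1) * partialDerangements x (b + 1) + (b + 1) * partialDerangements x b := by
  induction x generalizing b with
  | zero =>
    simp only [partialDerangements_zero, numDerangements_add_two]
    ring
  | succ x ih =>
    simp only [partialDerangements_succ]
    rw [ih (b + 1), ih b]
    ring

theorem partialDerangements_one (x : ℕ) :
    partialDerangements x 1 = x * partialDerangements x 0 := by
  induction x with
  | zero => simp [partialDerangements_zero]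
  | succ x ih =>
    simp only [partialDerangements_succ]
    rw [partialDerangements_add_two x 0, ih]
    ring

theorem partialDerangements_zero_right (x : ℕ) : partialDerangements x 0 = x.factorial := by
  induction x with
  | zero => rfl
  | succ x ih =>
    rw [partialDerangements_succ, partialDerangements_one, ih, Nat.factorial_succ]
    ring

/-- The bound on `b` is needed: for `x = 0` the values at `b = 0` and `b = 1` are `1` and `0`. -/
theorem partialDerangements_mono {x b : ℕ} (hb : 1 ≤ b) :
    partialDerangements x b ≤ partialDerangements x (b + 1) := by
  obtain ⟨b, rfl⟩ := Nat.exists_eq_add_of_le' hb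
  rw [partialDerangements_add_two]
  nlinarith [Nat.zero_le ((x + b) * partialDerangements x (b + 1)),
    Nat.zero_le ((b + 1) * partialDerangements x b)]

open Finset in
-- Permutations are classified by the set `B` of points of `S` that they move; summing over `B`
-- makes the points of `S` free.
theorem sum_powerset_partialDerangements (S : Finset ℕ) (x c : ℕ) :
    ∑ B ∈ S.powerset, partialDerangements x (c + #B) = partialDerangements (x + #S) c := by
  induction S using Finset.induction_on generalizing c with
  | empty => simp
  | insert a S ha ih =>
    rw [sum_powerset_insert ha, ih, card_insert_of_notMem ha, ← add_assoc,
      partialDerangements_succ, ← ih, add_comm, ← ih (c + 1)]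
    congr 1
    refine sum_congr rfl fun B hB => ?_
    rw [card_insert_of_notMem fun h => ha (mem_powerset.1 hB h)]
    congr 1
    omega

/-! ### Resolving conflicts between complementary layers. -/

/-- The inequality behind averaging over the middle layer. -/
theorem mul_partialDerangements_le {x b t : ℕ} (hb : 1 ≤ b) (h : t + 1 ≤ x + 2 * b) :
    (2 * b + t - 1) * partialDerangements x b ≤ b * partialDerangements (x + 1) b ∧
      (b = 1 → (2 * b + t - 1) * partialDerangements x b < b * partialDerangements (x + 1) b) := by
  obtain ⟨b, rfl⟩ := Nat.exists_eq_add_of_le' hb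
  have hpos : 0 < partialDerangements x 0 := by
    rw [partialDerangements_zero_right]; exact x.factorial_pos
  -- `(b + 1) * (x + b + 2)` is the coefficient of `partialDerangements x (b + 1)` on the right
  -- after the recurrence. The leftover term `(b + 1)²` times `partialDerangements x b` is positive
  -- for `b = 0`, which gives strictness in the lowest case.
  have hcoef : 2 * (b + 1) + t - 1 ≤ (b + 1) * (x + b + 2) := by
    have : 2 * (b + 1) + t - 1 ≤ 2 * (b + 1) + (x + 2 * b) := by omega
    refine this.trans ?_
    nlinarith [Nat.zero_le (b * x), Nat.le_mul_self b]
  have hmul := Nat.mul_le_mul_right (partialDerangements x (b + 1)) hcoef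
  rw [partialDerangements_succ, partialDerangements_add_two]
  have heq : (b + 1) * ((x + b + 1) * partialDerangements x (b + 1) +
      (b + 1) * partialDerangements x b + partialDerangements x (b + 1)) =
      (b + 1) * (x + b + 2) * partialDerangements x (b + 1) +
      (b + 1) * (b + 1) * partialDerangements x b := by ring
  rw [heq]
  refine ⟨by omega, fun h1 => ?_⟩
  obtain rfl : b = 0 := by omega
  omega

open Finset in
/-- Averaging over the points of `range m`: some point is missed by many members. -/
theorem exists_mul_card_le_mul_card_filter_notMem {m b : ℕ} (hm : 0 < m)
    (𝒟 : Finset (Finset ℕ)) (h𝒟 : ∀ Y ∈ 𝒟, Y ⊆ range m ∧ m - #Y = b) :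
    ∃ l ∈ range m, b * #𝒟 ≤ m * #{Y ∈ 𝒟 | l ∉ Y} := by
  by_contra! hlt
  have hsum : ∑ l ∈ range m, #{Y ∈ 𝒟 | l ∉ Y} = b * #𝒟 := by
    have hdc := sum_card_bipartiteAbove_eq_sum_card_bipartiteBelow
      (s := range m) (t := 𝒟) (fun l Y => l ∉ Y)
    simp only [bipartiteAbove, bipartiteBelow] at hdc
    rw [hdc, sum_congr rfl (g := fun _ => b), sum_const, smul_eq_mul, mul_comm]
    intro Y hY
    obtain ⟨hsub, hcard⟩ := h𝒟 Y hY
    rw [filter_notMem_eq_sdiff, card_sdiff_of_subset hsub, card_range, hcard]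
  have hlt' := sum_lt_sum_of_nonempty (nonempty_range_iff.2 hm.ne') hlt
  rw [← mul_sum, hsum] at hlt'
  simp at hlt'

/-- Keeping the layer with `d` sets gains exactly `partialDerangements x (b + 1) * d` from the new
free point, and this must exceed the weight of the discarded layer. -/
theorem add_lt_of_layer_selected {x b b' d d' : ℕ}
    (h : partialDerangements x b' * d' < partialDerangements x (b + 1) * d) :
    partialDerangements x b * d + partialDerangements x b' * d' <
      partialDerangements (x + 1) b * d := by
  rw [partialDerangements_succ, add_mul]
  omega

theorem add_le_of_layer_not_selected {x b b' d d' : ℕ} (hb : 1 ≤ b) (hb' : 1 ≤ b')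
    (h : ¬ partialDerangements x b' * d' < partialDerangements x (b + 1) * d) :
    partialDerangements x b * d + partialDerangements x b' * d' ≤
      partialDerangements (x + 1) b' * d' := by
  have h1 := Nat.mul_le_mul_right d (partialDerangements_mono (x := x) hb)
  have h2 := Nat.mul_le_mul_right d' (partialDerangements_mono (x := x) hb')
  rw [partialDerangements_succ, add_mul]
  omega

/-- Here `k` counts the sets of a self-complementary layer that miss one well-chosen point. -/
theorem layer_middle {x b t d k : ℕ} (hb : 1 ≤ b) (h : t + 1 ≤ x + 2 * b)
    (hk : b * d ≤ (2 * b + t - 1) * k) :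
    partialDerangements x b * d ≤ partialDerangements (x + 1) b * k ∧
      (b = 1 → 0 < k → partialDerangements x b * d < partialDerangements (x + 1) b * k) := by
  obtain ⟨hle, hlt⟩ := mul_partialDerangements_le hb h
  have key : b * (partialDerangements x b * d) ≤ (2 * b + t - 1) * partialDerangements x b * k := by
    calc b * (partialDerangements x b * d) = partialDerangements x b * (b * d) := by ring
      _ ≤ partialDerangements x b * ((2 * b + t - 1) * k) := Nat.mul_le_mul_left _ hk
      _ = _ := by ring
  constructor
  · refine Nat.le_of_mul_le_mul_left (c := b) ?_ hb
    calc _ ≤ _ := key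
      _ ≤ b * partialDerangements (x + 1) b * k := Nat.mul_le_mul_right _ hle
      _ = _ := by ring
  · intro hb1 hk0
    refine Nat.lt_of_mul_lt_mul_left (a := b) ?_
    calc _ ≤ _ := key
      _ < b * partialDerangements (x + 1) b * k := Nat.mul_lt_mul_of_pos_right (hlt hb1) hk0
      _ = _ := by ring

open Finset in
/-- A family whose pairs are `t`-intersecting, except for pairs of complementary layers that cover
`range m`, has a `t`-intersecting subfamily of at least the same weight, where the weight of the
subfamily refers to one further free point. -/
theorem exists_intersecting_subfamily {x m t s : ℕ} (ht : 1 ≤ t) (hs : s + t = m + 1)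
    (hxs : t + 1 ≤ x + s) (𝒟 : Finset (Finset ℕ)) (hsub : ∀ Y ∈ 𝒟, Y ⊆ range m)
    (hcard : ∀ Y ∈ 𝒟, t ≤ #Y)
    (hint : ∀ Y ∈ 𝒟, ∀ Z ∈ 𝒟, t ≤ #(Y ∩ Z) ∨ (#Y + #Z + 1 = m + t ∧ Y ∪ Z = range m)) :
    ∃ 𝒟' ⊆ 𝒟, (∀ Y ∈ 𝒟', ∀ Z ∈ 𝒟', t ≤ #(Y ∩ Z)) ∧
      ∑ Y ∈ 𝒟, partialDerangements x (m - #Y) ≤ ∑ Y ∈ 𝒟', partialDerangements (x + 1) (m - #Y) ∧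
      ((∃ Y ∈ 𝒟', #Y = t) → ∑ Y ∈ 𝒟, partialDerangements x (m - #Y) <
        ∑ Y ∈ 𝒟', partialDerangements (x + 1) (m - #Y)) := by
  classical
  have hYm : ∀ Y ∈ 𝒟, #Y ≤ m := fun Y hY => by simpa using card_le_card (hsub Y hY)
  -- Layers are indexed by the number `b` of missing points. Two layers can conflict only if their
  -- indices add up to `s`; since `t ≤ #Y`, only `b < s` occurs, so layer `0` has no partner.
  set L : ℕ → Finset (Finset ℕ) := fun b => {Y ∈ 𝒟 | m - #Y = b} with hL
  have hmid : ∃ l, ∀ b, 1 ≤ b → 2 * b = s →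
      l ∈ range m ∧ b * #(L b) ≤ (2 * b + t - 1) * #{Y ∈ L b | l ∉ Y} := by
    by_cases hex : ∃ b, 1 ≤ b ∧ 2 * b = s
    · obtain ⟨b, hb, hbs⟩ := hex
      obtain ⟨l, hl, hle⟩ := exists_mul_card_le_mul_card_filter_notMem (m := m) (b := b)
        (by omega) (L b) fun Y hY => ⟨hsub Y (mem_filter.1 hY).1, (mem_filter.1 hY).2⟩
      refine ⟨l, fun b' _ hbs' => ?_⟩
      obtain rfl : b' = b := by omega
      refine ⟨hl, ?_⟩
      rwa [show 2 * b' + t - 1 = m by omega]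
    · push Not at hex
      exact ⟨0, fun b hb hbs => absurd hbs (hex b hb)⟩
  obtain ⟨l, hl⟩ := hmid
  let sel : ℕ → Prop := fun b =>
    partialDerangements x (s - b) * #(L (s - b)) < partialDerangements x (b + 1) * #(L b)
  -- The sets kept: all of layer `0`; in the middle layer those missing `l`, no two of which cover
  -- `range m`; from every other conflicting pair a single layer, chosen by `sel` at the larger
  -- index.
  let c : ℕ → Finset (Finset ℕ) := fun b =>
    if b = 0 then L 0 else if 2 * b = s then {Y ∈ L b | l ∉ Y} else
      if s < 2 * b then (if sel b then L b else ∅) else (if sel (s - b) then ∅ else L b)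
  have hcL : ∀ b, c b ⊆ L b := by
    intro b
    simp only [c]
    split_ifs with h0 <;> simp [h0]
  -- The gain of weight in layer `b`, possibly negative; only the sums `e b + e (s - b)` are
  -- controlled.
  let e : ℕ → ℤ := fun b =>
    (partialDerangements (x + 1) b * #(c b) : ℕ) - (partialDerangements x b * #(L b) : ℕ)
  have he0 : 0 ≤ e 0 ∧ (s = 1 → (c 0).Nonempty → 0 < e 0) := by
    simp only [e, c, if_true]
    rw [partialDerangements_succ, add_mul]
    refine ⟨by omega, fun h1 hne => ?_⟩
    have h1 : 0 < partialDerangements x (0 + 1) := by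
      rw [zero_add, partialDerangements_one, partialDerangements_zero_right]
      exact Nat.mul_pos (by omega) x.factorial_pos
    have := Nat.mul_pos h1 hne.card_pos
    omega
  -- the upper member of a pair of distinct layers
  have hup : ∀ b, 1 ≤ b → b < s → s < 2 * b →
      0 ≤ e b + e (s - b) ∧ ((c b).Nonempty → 0 < e b + e (s - b)) := by
    intro b hb hbs h2
    have e1 : c b = if sel b then L b else ∅ := by
      simp only [c]; rw [if_neg (by omega), if_neg (by omega), if_pos h2]
    have e2 : c (s - b) = if sel b then ∅ else L (s - b) := by
      simp only [c]
      rw [if_neg (by omega), if_neg (by omega), if_neg (by omega), show s - (s - b) = b by omega]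
    simp only [e, e1, e2]
    by_cases hsel : sel b
    · have := add_lt_of_layer_selected hsel
      simp only [if_pos hsel, card_empty, mul_zero]
      constructor
      · omega
      · intro; omega
    · have := add_le_of_layer_not_selected (b' := s - b) hb (by omega) hsel
      simp only [if_neg hsel, card_empty, mul_zero]
      refine ⟨by omega, fun h => by simp at h⟩
  have hpair : ∀ b, 1 ≤ b → b < s →
      0 ≤ e b + e (s - b) ∧ (b = s - 1 → (c b).Nonempty → 0 < e b + e (s - b)) := by
    intro b hb hbs
    rcases lt_trichotomy s (2 * b) with h | h | h
    · exact ⟨(hup b hb hbs h).1, fun _ => (hup b hb hbs h).2⟩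
    · have hsb : s - b = b := by omega
      have e1 : c b = {Y ∈ L b | l ∉ Y} := by
        simp only [c]; rw [if_neg (by omega), if_pos h.symm]
      obtain ⟨hle, hlt⟩ := layer_middle (x := x) hb (by omega) (hl b hb h.symm).2
      rw [hsb]
      simp only [e, e1]
      refine ⟨by omega, fun hb1 hne => ?_⟩
      have := hlt (by omega) hne.card_pos
      omega
    · have := (hup (s - b) (by omega) (by omega) (by omega)).1
      rw [show s - (s - b) = b by omega, add_comm] at this
      exact ⟨this, fun hb1 => by omega⟩
  have hdisj : ∀ (f : ℕ → Finset (Finset ℕ)), (∀ b, f b ⊆ L b) →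
      ((range s : Finset ℕ) : Set ℕ).PairwiseDisjoint f := by
    intro f hf b _ b' _ hne
    refine disjoint_left.2 fun Y hY hY' => hne ?_
    rw [← (mem_filter.1 (hf b hY)).2, ← (mem_filter.1 (hf b' hY')).2]
  have hwt : ∀ (f : ℕ → Finset (Finset ℕ)) (y : ℕ), (∀ b, f b ⊆ L b) →
      ∑ Y ∈ (range s).biUnion f, partialDerangements y (m - #Y) =
        ∑ b ∈ range s, partialDerangements y b * #(f b) := by
    intro f y hf
    rw [sum_biUnion (hdisj f hf)]
    refine sum_congr rfl fun b _ => ?_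
    rw [sum_congr rfl (g := fun _ => partialDerangements y b), sum_const, smul_eq_mul, mul_comm]
    intro Y hY
    rw [(mem_filter.1 (hf b hY)).2]
  have h𝒟 : (range s).biUnion L = 𝒟 := by
    ext Y
    simp only [mem_biUnion, mem_range, hL, mem_filter]
    constructor
    · rintro ⟨b, _, h, _⟩; exact h
    · intro h
      have := hcard Y h
      have := hYm Y h
      exact ⟨m - #Y, by omega, h, rfl⟩
  have hs1 : 1 ≤ s ∨ 𝒟 = ∅ := by
    by_contra! hcon
    obtain ⟨Y, hY⟩ := hcon.2
    have := hcard Y hY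
    have := hYm Y hY
    omega
  have hsplit : 1 ≤ s → 2 * ∑ b ∈ range s, e b =
      2 * e 0 + ∑ b ∈ Ico 1 s, (e b + e (s - b)) := by
    intro h1
    have hrefl : ∑ b ∈ Ico 1 s, e (s - b) = ∑ b ∈ Ico 1 s, e b := by
      refine sum_nbij' (fun b => s - b) (fun b => s - b) ?_ ?_ ?_ ?_ ?_ <;>
        simp only [mem_Ico] <;> intros <;> first | omega | trivial
    rw [sum_add_distrib, hrefl, range_eq_Ico, sum_eq_sum_Ico_succ_bot (by omega)]
    ring
  have hdiff : ((∑ Y ∈ (range s).biUnion c, partialDerangements (x + 1) (m - #Y) : ℕ) : ℤ) -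
      (∑ Y ∈ 𝒟, partialDerangements x (m - #Y) : ℕ) = ∑ b ∈ range s, e b := by
    rw [hwt c _ hcL]
    conv_lhs => rw [← h𝒟]
    rw [hwt L _ fun b => Subset.rfl, sum_sub_distrib]
    push_cast
    rfl
  refine ⟨(range s).biUnion c, ?_, ?_, ?_, ?_⟩
  · intro Y hY
    obtain ⟨b, _, hYb⟩ := mem_biUnion.1 hY
    exact (mem_filter.1 (hcL b hYb)).1
  · intro Y hY Z hZ
    obtain ⟨b, hb, hYb⟩ := mem_biUnion.1 hY
    obtain ⟨b', hb', hZb⟩ := mem_biUnion.1 hZ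
    obtain ⟨hY𝒟, hYc⟩ := mem_filter.1 (hcL b hYb)
    obtain ⟨hZ𝒟, hZc⟩ := mem_filter.1 (hcL b' hZb)
    refine (hint Y hY𝒟 Z hZ𝒟).resolve_right ?_
    rintro ⟨hsum, hun⟩
    have := hYm Y hY𝒟
    have := hYm Z hZ𝒟
    have hbs := mem_range.1 hb
    have hbs' := mem_range.1 hb'
    have hbb : b + b' = s := by omega
    have hexcl : ∀ b, 1 ≤ b → b < s → s < 2 * b → (c b).Nonempty → ¬ (c (s - b)).Nonempty := by
      intro b hb hbs h2
      have e1 : c b = if sel b then L b else ∅ := by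
        simp only [c]; rw [if_neg (by omega), if_neg (by omega), if_pos h2]
      have e2 : c (s - b) = if sel b then ∅ else L (s - b) := by
        simp only [c]
        rw [if_neg (by omega), if_neg (by omega), if_neg (by omega), show s - (s - b) = b by omega]
      rw [e1, e2]
      split_ifs <;> simp
    rcases lt_trichotomy s (2 * b) with h | h | h
    · refine hexcl b (by omega) hbs h ⟨Y, hYb⟩ ⟨Z, ?_⟩
      rwa [show s - b = b' by omega]
    · obtain rfl : b' = b := by omega
      have e1 : c b' = {Y ∈ L b' | l ∉ Y} := by
        simp only [c]; rw [if_neg (by omega), if_pos h.symm]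
      rw [e1] at hYb hZb
      have hlm := (hl b' (by omega) h.symm).1
      rw [← hun, mem_union] at hlm
      exact hlm.elim (mem_filter.1 hYb).2 (mem_filter.1 hZb).2
    · refine hexcl b' (by omega) hbs' (by omega) ⟨Z, hZb⟩ ⟨Y, ?_⟩
      rwa [show s - b' = b by omega]
  · rcases hs1 with h1 | h1
    · have hnn : 0 ≤ ∑ b ∈ Ico 1 s, (e b + e (s - b)) :=
        sum_nonneg fun b hb => (hpair b (mem_Ico.1 hb).1 (mem_Ico.1 hb).2).1
      have := hsplit h1
      have := he0.1
      omega
    · simp [h1]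
  -- A `t`-set lies in layer `s - 1`: this is layer `0` if `s = 1`, the middle layer with `b = 1` if
  -- `s = 2`, and the upper layer of its pair otherwise. Each case has a strict gain.
  · rintro ⟨Y, hY, hYt⟩
    obtain ⟨b, hb, hYb⟩ := mem_biUnion.1 hY
    have hYc := (mem_filter.1 (hcL b hYb)).2
    have hbs := mem_range.1 hb
    have hnn : ∀ b ∈ Ico 1 s, 0 ≤ e b + e (s - b) :=
      fun b hb => (hpair b (mem_Ico.1 hb).1 (mem_Ico.1 hb).2).1
    have := hsplit (by omega)
    have h0 := he0.1
    by_cases hb0 : b = 0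
    · subst hb0
      have := he0.2 (by omega) ⟨Y, hYb⟩
      have := sum_nonneg hnn
      omega
    · have : 0 < ∑ b ∈ Ico 1 s, (e b + e (s - b)) :=
        sum_pos' hnn ⟨b, mem_Ico.2 ⟨by omega, hbs⟩,
          (hpair b (by omega) hbs).2 (by omega) ⟨Y, hYb⟩⟩
      omega

/-! ### Left-shifting and up-closure of set families. -/

/-- Any two members, equal ones included, share at least `t` points. -/
def IsPairwiseIntersecting (t : ℕ) (𝒜 : Finset (Finset ℕ)) : Prop :=
  ∀ A ∈ 𝒜, ∀ B ∈ 𝒜, t ≤ (A ∩ B).card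

open Finset in
/-- Replace `j` by `i` in `A` if this is possible and leads to a set outside `𝒜`. -/
def shiftSet (i j : ℕ) (𝒜 : Finset (Finset ℕ)) (A : Finset ℕ) : Finset ℕ :=
  if j ∈ A ∧ i ∉ A ∧ insert i (A.erase j) ∉ 𝒜 then insert i (A.erase j) else A

section shift

open Finset

variable {i j t : ℕ} {𝒜 : Finset (Finset ℕ)}

theorem card_insert_erase {A : Finset ℕ} (hj : j ∈ A) (hi : i ∉ A) :
    #(insert i (A.erase j)) = #A := by
  rw [card_insert_of_notMem (fun h => hi (mem_of_mem_erase h)), card_erase_add_one hj]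

theorem card_shiftSet (A : Finset ℕ) : #(shiftSet i j 𝒜 A) = #A := by
  unfold shiftSet
  split_ifs with h
  · exact card_insert_erase h.1 h.2.1
  · rfl

theorem insert_erase_injective {A B : Finset ℕ} (hjA : j ∈ A) (hiA : i ∉ A) (hjB : j ∈ B)
    (hiB : i ∉ B) (h : insert i (A.erase j) = insert i (B.erase j)) : A = B := by
  ext a
  have := congrArg (a ∈ ·) h
  grind

theorem shiftSet_injOn : Set.InjOn (shiftSet i j 𝒜) 𝒜 := by
  intro A hA B hB h
  unfold shiftSet at h
  split_ifs at h with h1 h2 h2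
  · exact insert_erase_injective h1.1 h1.2.1 h2.1 h2.2.1 h
  · exact absurd (h ▸ hB) h1.2.2
  · exact absurd (h ▸ hA) h2.2.2
  · exact h

/-- If `B` stays only because its shift is already present, intersect `A` with that shift instead.
Otherwise `A ∩ B` loses nothing, or exchanges `j` for `i`. -/
theorem card_inter_shift_of_not_moved (h : IsPairwiseIntersecting t 𝒜) {A B : Finset ℕ}
    (hA : A ∈ 𝒜) (hB : B ∈ 𝒜) (hj : j ∈ A) (hi : i ∉ A)
    (hnot : ¬(j ∈ B ∧ i ∉ B ∧ insert i (B.erase j) ∉ 𝒜)) :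
    t ≤ #(insert i (A.erase j) ∩ B) := by
  by_cases hB' : j ∈ B ∧ i ∉ B
  · have hmem : insert i (B.erase j) ∈ 𝒜 := by
      by_contra hcon
      exact hnot ⟨hB'.1, hB'.2, hcon⟩
    refine (h A hA _ hmem).trans (card_le_card fun a ha => ?_)
    grind
  · refine (h A hA B hB).trans ?_
    by_cases hjB : j ∈ B
    · have hiB : i ∈ B := by grind
      have : insert i (A.erase j) ∩ B = insert i ((A ∩ B).erase j) := by
        ext a; grind
      rw [this, card_insert_erase] <;> grind
    · refine card_le_card fun a ha => ?_
      grind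

theorem IsPairwiseIntersecting.shift (h : IsPairwiseIntersecting t 𝒜) :
    IsPairwiseIntersecting t (𝒜.image (shiftSet i j 𝒜)) := by
  intro A' hA' B' hB'
  obtain ⟨A, hA, rfl⟩ := mem_image.1 hA'
  obtain ⟨B, hB, rfl⟩ := mem_image.1 hB'
  unfold shiftSet
  split_ifs with h1 h2 h2
  · have : insert i (A.erase j) ∩ insert i (B.erase j) = insert i ((A ∩ B).erase j) := by
      ext a; grind
    rw [this, card_insert_erase]
    · exact h A hA B hB
    · grind
    · grind
  · exact card_inter_shift_of_not_moved h hA hB h1.1 h1.2.1 h2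
  · rw [inter_comm]
    exact card_inter_shift_of_not_moved h hB hA h2.1 h2.2.1 h1
  · exact h A hA B hB

theorem IsPairwiseIntersecting.insert_superset (h : IsPairwiseIntersecting t 𝒜) {A B : Finset ℕ}
    (hA : A ∈ 𝒜) (hAB : A ⊆ B) : IsPairwiseIntersecting t (insert B 𝒜) := by
  have key : ∀ C ∈ 𝒜, t ≤ #(B ∩ C) := fun C hC =>
    (h A hA C hC).trans (card_le_card (inter_subset_inter_right hAB))
  intro C hC D hD
  rcases mem_insert.1 hC with rfl | hC' <;> rcases mem_insert.1 hD with rfl | hD'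
  · rw [inter_self]
    exact (h A hA A hA).trans (card_le_card (inter_subset_left.trans hAB))
  · exact key D hD'
  · rw [inter_comm]; exact key C hC'
  · exact h C hC' D hD'

/-- The potential that is increased by shifting and by adding members. -/
theorem potential_lt_insert_erase {m : ℕ} {A : Finset ℕ} (hij : i < j) (hj : j ∈ A) (hi : i ∉ A)
    (hA : A ⊆ range m) :
    1 + ∑ a ∈ range m \ A, a < 1 + ∑ a ∈ range m \ insert i (A.erase j), a := by
  have hjm := mem_range.1 (hA hj)
  have him : i ∈ range m \ A := by simp [hi]; omega
  have h2 : range m \ insert i (A.erase j) = insert j ((range m \ A).erase i) := by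
    ext a
    simp only [mem_sdiff, mem_range, mem_insert, mem_erase]
    grind
  rw [h2, sum_insert (by grind), ← add_sum_erase _ _ him]
  omega

/-- Every pairwise `t`-intersecting family without `t`-sets can be replaced by a left-shifted
up-set of at least the same weight. -/
theorem exists_shifted_upSet {m : ℕ} (w : ℕ → ℕ) (h : IsPairwiseIntersecting t 𝒜)
    (hsub : ∀ A ∈ 𝒜, A ⊆ range m) (hcard : ∀ A ∈ 𝒜, #A ≠ t) :
    ∃ ℬ : Finset (Finset ℕ), IsPairwiseIntersecting t ℬ ∧ (∀ A ∈ ℬ, A ⊆ range m) ∧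
      (∀ A ∈ ℬ, #A ≠ t) ∧ ∑ A ∈ 𝒜, w #A ≤ ∑ A ∈ ℬ, w #A ∧
      (∀ A ∈ ℬ, ∀ B, A ⊆ B → B ⊆ range m → B ∈ ℬ) ∧
      (∀ A ∈ ℬ, ∀ i j, i < j → j ∈ A → i ∉ A → insert i (A.erase j) ∈ ℬ) := by
  classical
  let good : Finset (Finset ℕ) → Prop := fun ℬ => IsPairwiseIntersecting t ℬ ∧
    (∀ A ∈ ℬ, #A ≠ t) ∧ ∑ A ∈ 𝒜, w #A ≤ ∑ A ∈ ℬ, w #A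
  -- The summand `1` rewards new members, and the sum over the complement rewards replacing `j` by a
  -- smaller `i`; a maximizer is therefore an up-set and left-shifted.
  let φ : Finset ℕ → ℕ := fun A => 1 + ∑ a ∈ range m \ A, a
  have hne : ((range m).powerset.powerset.filter good).Nonempty :=
    ⟨𝒜, mem_filter.2 ⟨mem_powerset.2 fun A hA => mem_powerset.2 (hsub A hA), h, hcard, le_rfl⟩⟩
  obtain ⟨ℬ, hℬ, hmax⟩ := exists_max_image _ (fun ℬ => ∑ A ∈ ℬ, φ A) hne
  obtain ⟨hℬsub, hℬint, hℬcard, hℬw⟩ := mem_filter.1 hℬ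
  have hℬsub' : ∀ A ∈ ℬ, A ⊆ range m := fun A hA =>
    mem_powerset.1 (mem_powerset.1 hℬsub hA)
  have hmax' : ∀ 𝒞 : Finset (Finset ℕ), (∀ A ∈ 𝒞, A ⊆ range m) → good 𝒞 →
      ∑ A ∈ 𝒞, φ A ≤ ∑ A ∈ ℬ, φ A := fun 𝒞 h1 h2 => hmax 𝒞
    (mem_filter.2 ⟨mem_powerset.2 fun A hA => mem_powerset.2 (h1 A hA), h2⟩)
  refine ⟨ℬ, hℬint, hℬsub', hℬcard, hℬw, ?_, ?_⟩
  · intro A hA B hAB hB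
    by_contra hBℬ
    have := hmax' (insert B ℬ) ?_ ⟨hℬint.insert_superset hA hAB, ?_, ?_⟩
    · rw [sum_insert hBℬ] at this
      simp only [φ] at this
      omega
    · intro C hC
      rcases mem_insert.1 hC with rfl | hC
      exacts [hB, hℬsub' C hC]
    · intro C hC
      rcases mem_insert.1 hC with rfl | hC
      · have h1 := hℬint A hA A hA
        rw [inter_self] at h1
        have h2 := hℬcard A hA
        have h3 := card_le_card hAB
        omega
      · exact hℬcard C hC
    · rw [sum_insert hBℬ]
      omega
  · intro A hA i j hij hj hi
    by_contra hnot
    have hinj : Set.InjOn (shiftSet i j ℬ) ℬ := shiftSet_injOn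
    have := hmax' (ℬ.image (shiftSet i j ℬ)) ?_ ⟨hℬint.shift, ?_, ?_⟩
    · rw [sum_image hinj] at this
      refine absurd this (not_le.2 (sum_lt_sum (fun B hB => ?_) ⟨A, hA, ?_⟩))
      · unfold shiftSet
        split_ifs with hB'
        · exact (potential_lt_insert_erase hij hB'.1 hB'.2.1 (hℬsub' B hB)).le
        · exact le_rfl
      · unfold shiftSet
        rw [if_pos ⟨hj, hi, hnot⟩]
        exact potential_lt_insert_erase hij hj hi (hℬsub' A hA)
    · intro C hC
      obtain ⟨B, hB, rfl⟩ := mem_image.1 hC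
      have hBs := hℬsub' B hB
      unfold shiftSet
      split_ifs with hB'
      · intro a ha
        rcases mem_insert.1 ha with rfl | ha
        · have := mem_range.1 (hBs hB'.1)
          exact mem_range.2 (by omega)
        · exact hBs (mem_of_mem_erase ha)
      · exact hBs
    · intro C hC
      obtain ⟨B, hB, rfl⟩ := mem_image.1 hC
      rw [card_shiftSet]
      exact hℬcard B hB
    · rw [sum_image hinj]
      simpa only [card_shiftSet] using hℬw

end shift

/-! ### The weighted bound for `t`-intersecting families of sets. -/

open Finset in
theorem subset_of_card_le_inter {α : Type*} [DecidableEq α] {T A : Finset α}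
    (h : #T ≤ #(T ∩ A)) : T ⊆ A := by
  rw [← eq_of_subset_of_card_le inter_subset_left h]
  exact inter_subset_right

open Finset in
-- All members contain `T`, and the weights of all supersets of `T` add up to the number of
-- permutations of the remaining `x + m - t` points.
theorem sum_partialDerangements_le_of_mem {x m t : ℕ} {𝒜 : Finset (Finset ℕ)}
    (h : IsPairwiseIntersecting t 𝒜) (hsub : ∀ A ∈ 𝒜, A ⊆ range m) {T : Finset ℕ} (hT : T ∈ 𝒜)
    (hTt : #T = t) :
    ∑ A ∈ 𝒜, partialDerangements x (m - #A) ≤ (x + m - t).factorial := by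
  have hTA : ∀ A ∈ 𝒜, T ⊆ A := fun A hA => subset_of_card_le_inter (hTt ▸ h T hT A hA)
  have hinj : Set.InjOn (fun A => range m \ A) (𝒜 : Set (Finset ℕ)) := fun A hA B hB hAB => by
    rw [← Finset.sdiff_sdiff_eq_self (hsub A hA), ← Finset.sdiff_sdiff_eq_self (hsub B hB)]
    exact congrArg (range m \ ·) hAB
  calc ∑ A ∈ 𝒜, partialDerangements x (m - #A)
      = ∑ B ∈ 𝒜.image (fun A => range m \ A), partialDerangements x (0 + #B) := by
        rw [sum_image hinj]
        refine sum_congr rfl fun A hA => ?_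
        rw [card_sdiff_of_subset (hsub A hA), card_range, zero_add]
    _ ≤ ∑ B ∈ (range m \ T).powerset, partialDerangements x (0 + #B) := by
        refine sum_le_sum_of_subset fun B hB => ?_
        obtain ⟨A, hA, rfl⟩ := mem_image.1 hB
        exact mem_powerset.2 (sdiff_subset_sdiff Subset.rfl (hTA A hA))
    _ = (x + m - t).factorial := by
        have hTm := card_le_card (hsub T hT)
        rw [card_range] at hTm
        rw [sum_powerset_partialDerangements, partialDerangements_zero_right,
          card_sdiff_of_subset (hsub T hT), card_range, hTt]
        congr 1
        omega

open Finset in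
/-- A pairwise `t`-intersecting family without `t`-sets has less weight than the family of all
supersets of a `t`-set. -/
theorem sum_partialDerangements_lt {t : ℕ} (ht : 1 ≤ t) (m : ℕ) : ∀ x : ℕ, 2 * t + 1 ≤ x + m →
    ∀ 𝒜 : Finset (Finset ℕ), IsPairwiseIntersecting t 𝒜 → (∀ A ∈ 𝒜, A ⊆ range m) →
      (∀ A ∈ 𝒜, #A ≠ t) →
      ∑ A ∈ 𝒜, partialDerangements x (m - #A) < (x + m - t).factorial := by
  classical
  induction m with
  | zero =>
    intro x _ 𝒜 h hsub _
    have : 𝒜 = ∅ := eq_empty_of_forall_notMem fun A hA => by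
      have h1 := h A hA A hA
      have h2 := hsub A hA
      simp only [range_zero, subset_empty] at h2
      simp only [h2, inter_self, card_empty] at h1
      omega
    simp [this, Nat.factorial_pos]
  | succ m ih =>
    intro x hx 𝒜₀ h₀ hsub₀ hcard₀
    obtain ⟨𝒜, h, hsub, hcard, hw, hup, hshift⟩ :=
      exists_shifted_upSet (fun k => partialDerangements x (m + 1 - k)) h₀ hsub₀ hcard₀
    refine hw.trans_lt ?_
    have hcard' : ∀ A ∈ 𝒜, t + 1 ≤ #A := fun A hA => by
      have h1 := h A hA A hA
      rw [inter_self] at h1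
      have h2 := hcard A hA
      omega
    by_cases hmt : m < t
    · have : 𝒜 = ∅ := eq_empty_of_forall_notMem fun A hA => by
        have h1 := hcard' A hA
        have h2 := card_le_card (hsub A hA)
        rw [card_range] at h2
        omega
      simp [this, Nat.factorial_pos]
    set P := (range m).powerset with hP
    set X := {Y ∈ P | Y ∈ 𝒜} with hX
    set D := {Y ∈ P | insert m Y ∈ 𝒜 ∧ Y ∉ 𝒜} with hD
    have hPm : ∀ Y ∈ P, m ∉ Y := fun Y hY hm => by
      simpa using mem_powerset.1 hY hm
    have hPs : ∀ Y ∈ P, Y ⊆ range m := fun Y hY => mem_powerset.1 hY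
    have hcm : ∀ Y ∈ P, #Y ≤ m := fun Y hY => by simpa using card_le_card (hPs Y hY)
    have hXD : Disjoint X D := disjoint_left.2 fun Y h1 h2 =>
      (mem_filter.1 h2).2.2 (mem_filter.1 h1).2
    have hZ : {Y ∈ P | insert m Y ∈ 𝒜} = X ∪ D := by
      ext Y
      simp only [hX, hD, mem_union, mem_filter]
      constructor
      · rintro ⟨h1, h2⟩
        by_cases h3 : Y ∈ 𝒜
        · exact Or.inl ⟨h1, h3⟩
        · exact Or.inr ⟨h1, h2, h3⟩
      · rintro (⟨h1, h2⟩ | ⟨h1, h2, h3⟩)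
        · refine ⟨h1, hup Y h2 _ (subset_insert _ _) ?_⟩
          rw [range_add_one]
          exact insert_subset_insert _ (hPs Y h1)
        · exact ⟨h1, h2⟩
    -- A set `Y` in `X` occurs in `𝒜` both with and without `m`, and the two weights add up to one
    -- weight with `m` free. A set in `D` occurs only with `m`.
    have hweight : ∑ A ∈ 𝒜, partialDerangements x (m + 1 - #A) =
        ∑ Y ∈ X, partialDerangements (x + 1) (m - #Y) +
          ∑ Y ∈ D, partialDerangements x (m - #Y) := by
      have h1 : 𝒜 = {Y ∈ (range (m + 1)).powerset | Y ∈ 𝒜} := by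
        ext A
        simp only [mem_filter, mem_powerset]
        exact ⟨fun hA => ⟨hsub A hA, hA⟩, fun hA => hA.2⟩
      conv_lhs => rw [h1]
      rw [sum_filter, range_add_one, sum_powerset_insert notMem_range_self, ← sum_filter,
        ← sum_filter, hZ, sum_union hXD, ← add_assoc, ← sum_add_distrib]
      congr 1
      · refine sum_congr rfl fun Y hY => ?_
        have hYP := (mem_filter.1 hY).1
        rw [card_insert_of_notMem (hPm Y hYP), partialDerangements_succ,
          show m + 1 - #Y = m - #Y + 1 by have := hcm Y hYP; omega,
          show m + 1 - (#Y + 1) = m - #Y by omega]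
      · refine sum_congr rfl fun Y hY => ?_
        have hYP := (mem_filter.1 hY).1
        rw [card_insert_of_notMem (hPm Y hYP), show m + 1 - (#Y + 1) = m - #Y by omega]
    have hDcard : ∀ Y ∈ D, t ≤ #Y := fun Y hY => by
      have h1 := hcard' _ (mem_filter.1 hY).2.1
      rw [card_insert_of_notMem (hPm Y (mem_filter.1 hY).1)] at h1
      omega
    have hDint : ∀ Y ∈ D, ∀ Z ∈ D,
        t ≤ #(Y ∩ Z) ∨ (#Y + #Z + 1 = m + t ∧ Y ∪ Z = range m) := by
      intro Y hY Z hZ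
      obtain ⟨hYP, hY1, _⟩ := mem_filter.1 hY
      obtain ⟨hZP, hZ1, _⟩ := mem_filter.1 hZ
      have hmY := hPm Y hYP
      have hmZ := hPm Z hZP
      by_cases hlt : t ≤ #(Y ∩ Z)
      · exact Or.inl hlt
      right
      have h1 := h _ hY1 _ hZ1
      rw [← insert_inter_distrib, card_insert_of_notMem (by simp [hmY])] at h1
      -- If `l` were in neither set, shifting `m` to `l` in one of them would destroy their common
      -- point `m` without replacing it.
      have hun : Y ∪ Z = range m := by
        refine (union_subset (hPs Y hYP) (hPs Z hZP)).antisymm fun l hl => ?_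
        by_contra hlYZ
        have hlm := mem_range.1 hl
        rw [mem_union, not_or] at hlYZ
        have hlY : l ∉ insert m Y := by simp [hlYZ.1, hlm.ne]
        have hlZ : l ∉ insert m Z := by simp [hlYZ.2, hlm.ne]
        have h2 := hshift _ hY1 l m hlm (mem_insert_self _ _) hlY
        have h3 := h _ h2 _ hZ1
        have h4 : insert l ((insert m Y).erase m) ∩ insert m Z = Y ∩ Z := by
          rw [erase_insert hmY, insert_inter_of_notMem hlZ, inter_insert_of_notMem hmY]
        rw [h4] at h3
        exact hlt h3
      refine ⟨?_, hun⟩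
      have h2 := card_union_add_card_inter Y Z
      rw [hun, card_range] at h2
      omega
    obtain ⟨D', hD'D, hD'int, hle, hlt⟩ := exists_intersecting_subfamily (x := x) (m := m)
      (s := m + 1 - t) ht (by omega) (by omega) D (fun Y hY => hPs Y (mem_filter.1 hY).1)
      hDcard hDint
    have hXD' : Disjoint X D' := disjoint_of_subset_right hD'D hXD
    have hnew : IsPairwiseIntersecting t (X ∪ D') := by
      have hmixed : ∀ Y ∈ X, ∀ Z ∈ D', t ≤ #(Y ∩ Z) := by
        intro Y hY Z hZ
        have h1 := h Y (mem_filter.1 hY).2 _ (mem_filter.1 (hD'D hZ)).2.1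
        rwa [inter_insert_of_notMem (hPm Y (mem_filter.1 hY).1)] at h1
      intro Y hY Z hZ
      rcases mem_union.1 hY with hY | hY <;> rcases mem_union.1 hZ with hZ | hZ
      · exact h Y (mem_filter.1 hY).2 Z (mem_filter.1 hZ).2
      · exact hmixed Y hY Z hZ
      · rw [inter_comm]; exact hmixed Z hZ Y hY
      · exact hD'int Y hY Z hZ
    have hnewsub : ∀ Y ∈ X ∪ D', Y ⊆ range m := fun Y hY => by
      rcases mem_union.1 hY with hY | hY
      · exact hPs Y (mem_filter.1 hY).1
      · exact hPs Y (mem_filter.1 (hD'D hY)).1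
    have hsum : ∑ Y ∈ X ∪ D', partialDerangements (x + 1) (m - #Y) =
        ∑ Y ∈ X, partialDerangements (x + 1) (m - #Y) +
          ∑ Y ∈ D', partialDerangements (x + 1) (m - #Y) := sum_union hXD'
    rw [hweight, show x + (m + 1) - t = x + 1 + m - t by omega]
    -- If removing `m` produced a `t`-set, the induction hypothesis is unavailable, but the strict
    -- gain in `D'` combined with the weak bound suffices.
    by_cases hex : ∃ Y ∈ D', #Y = t
    · have h1 := hlt hex
      obtain ⟨T, hT, hTt⟩ := hex
      have h2 := sum_partialDerangements_le_of_mem (x := x + 1) hnew hnewsub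
        (mem_union_right _ hT) hTt
      omega
    · have h2 := ih (x + 1) (by omega) (X ∪ D') hnew hnewsub ?_
      · omega
      · intro Y hY
        rcases mem_union.1 hY with hY | hY
        · exact hcard Y (mem_filter.1 hY).2
        · exact fun hYt => hex ⟨Y, hY, hYt⟩

/-! ### Detaching a point from its cycle. -/

section cycles

open Finset Equiv

variable {n : ℕ} {i j : Fin n} {σ π : Perm (Fin n)}

theorem inl_mem_permCycles {x : Fin n} : Sum.inl x ∈ permCycles σ ↔ σ x = x := by
  simp [permCycles]

theorem inr_mem_permCycles {c : Perm (Fin n)} :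
    Sum.inr c ∈ permCycles σ ↔ c.IsCycle ∧ ∀ a, c a ≠ a → c a = σ a := by
  simp [permCycles, Perm.mem_cycleFactorsFinset_iff]

/-- The cycle `z` contains neither `i` nor `j`. -/
def CycleAvoids (i j : Fin n) (z : Fin n ⊕ Perm (Fin n)) : Prop :=
  Sum.elim (fun x => x ≠ i ∧ x ≠ j) (fun c => c i = i ∧ c j = j) z

theorem CycleAvoids.mem_swap_mul {z : Fin n ⊕ Perm (Fin n)} (hz : CycleAvoids i j z)
    (h : z ∈ permCycles σ) : z ∈ permCycles (swap i j * σ) := by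
  rcases z with x | c
  · rw [inl_mem_permCycles] at h ⊢
    rw [Perm.mul_apply, h, swap_apply_of_ne_of_ne hz.1 hz.2]
  · rw [inr_mem_permCycles] at h ⊢
    refine ⟨h.1, fun a ha => ?_⟩
    have hca : c (c a) ≠ c a := fun hcon => ha (c.injective hcon)
    rw [Perm.mul_apply, ← h.2 a ha, swap_apply_of_ne_of_ne]
    · intro hcon; rw [hcon] at hca; exact hca hz.1
    · intro hcon; rw [hcon] at hca; exact hca hz.2

theorem cycleAvoids_of_mem (hij : i ≠ j) {z : Fin n ⊕ Perm (Fin n)} (hσ : σ i = j)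
    (h : z ∈ permCycles σ) (hz : ∀ c, z = Sum.inr c → c i = i) : CycleAvoids i j z := by
  rcases z with x | c
  · rw [inl_mem_permCycles] at h
    refine ⟨?_, ?_⟩
    · rintro rfl; exact hij (h.symm.trans hσ)
    · rintro rfl; exact hij (σ.injective (hσ.trans h.symm))
  · rw [inr_mem_permCycles] at h
    have hi : c i = i := hz c rfl
    refine ⟨hi, ?_⟩
    by_contra hj
    have hk : c (c.symm j) ≠ c.symm j := by
      rw [apply_symm_apply]
      intro hcon
      exact hj (by conv_lhs => rw [hcon, apply_symm_apply])
    have h3 := h.2 _ hk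
    rw [apply_symm_apply, ← hσ] at h3
    have h4 := σ.injective h3
    have h5 : j = c i := by rw [h4, apply_symm_apply]; exact hσ.symm
    exact hij (hi.symm.trans h5.symm)

/-- A common cycle through `i` would force `π i = σ i = j`, and a cycle of `σ` through `j` also
passes through `i`. -/
theorem cycleAvoids_of_mem_of_mem (hij : i ≠ j) {z : Fin n ⊕ Perm (Fin n)} (hσ : σ i = j)
    (hπ : π i ≠ j) (h1 : z ∈ permCycles σ) (h2 : z ∈ permCycles π) : CycleAvoids i j z := by
  refine cycleAvoids_of_mem hij hσ h1 ?_
  rintro c rfl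
  rw [inr_mem_permCycles] at h1 h2
  by_contra hi
  exact hπ ((h2.2 i hi).symm.trans ((h1.2 i hi).trans hσ))

theorem swap_mul_swap_mul_self (i j : Fin n) (σ : Perm (Fin n)) :
    swap i j * (swap i j * σ) = σ := by
  rw [← mul_assoc, swap_mul_self, one_mul]

theorem swap_mul_apply_left (hσ : σ i = j) : (swap i j * σ) i = i := by
  rw [Perm.mul_apply, hσ, swap_apply_right]

/-- Detaching `i` from its cycle in two permutations that map `i` to `j` does not destroy common
cycles. -/
theorem card_common_le_card_common_swap_mul (hij : i ≠ j) (hσ : σ i = j) (hπ : π i = j) :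
    #(permCycles σ ∩ permCycles π) ≤
      #(permCycles (swap i j * σ) ∩ permCycles (swap i j * π)) := by
  classical
  -- A common cycle through `i` is replaced by the new common fixed point `i`. This is injective
  -- because `σ` has only one cycle through `i` and does not fix `i`.
  let f : Fin n ⊕ Perm (Fin n) → Fin n ⊕ Perm (Fin n) :=
    Sum.elim Sum.inl (fun c => if c i = i then Sum.inr c else Sum.inl i)
  have hfl : ∀ x, f (Sum.inl x) = Sum.inl x := fun _ => rfl
  have hfr : ∀ c, f (Sum.inr c) = if c i = i then Sum.inr c else Sum.inl i := fun _ => rfl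
  have hxi : ∀ x, Sum.inl x ∈ permCycles σ → x ≠ i := by
    rintro x hx rfl
    rw [inl_mem_permCycles] at hx
    exact hij (hx.symm.trans hσ)
  have hav : ∀ τ : Perm (Fin n), τ i = j → ∀ z ∈ permCycles τ, f z ≠ Sum.inl i →
      f z = z ∧ CycleAvoids i j z := by
    intro τ hτ z hz hfz
    rcases z with x | c
    · exact ⟨rfl, cycleAvoids_of_mem hij hτ hz (by simp)⟩
    · have hci : c i = i := by
        by_contra hci
        exact hfz (by rw [hfr, if_neg hci])
      refine ⟨by rw [hfr, if_pos hci], cycleAvoids_of_mem hij hτ hz ?_⟩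
      rintro d hd
      rwa [← Sum.inr_injective hd]
  refine card_le_card_of_injOn f ?_ ?_
  · intro z hz
    obtain ⟨h1, h2⟩ := mem_inter.1 hz
    refine mem_inter.2 ?_
    by_cases hfz : f z = Sum.inl i
    · rw [hfz, inl_mem_permCycles, inl_mem_permCycles]
      exact ⟨swap_mul_apply_left hσ, swap_mul_apply_left hπ⟩
    · obtain ⟨he, ha⟩ := hav σ hσ z h1 hfz
      rw [he]
      exact ⟨ha.mem_swap_mul h1, ha.mem_swap_mul h2⟩
  · intro z hz w hw hzw
    have h1 := (mem_inter.1 hz).1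
    have h2 := (mem_inter.1 hw).1
    by_cases hfz : f z = Sum.inl i
    · have hfw := hzw.symm.trans hfz
      rcases z with x | c
      · exact absurd (Sum.inl_injective hfz) (hxi x h1)
      rcases w with y | d
      · exact absurd (Sum.inl_injective hfw) (hxi y h2)
      have hci : c i ≠ i := fun h => by simp [hfr, h] at hfz
      have hdi : d i ≠ i := fun h => by simp [hfr, h] at hfw
      have hc : c ∈ σ.cycleFactorsFinset := by simpa [permCycles] using h1
      have hd : d ∈ σ.cycleFactorsFinset := by simpa [permCycles] using h2
      rw [Perm.eq_cycleOf_of_mem_cycleFactorsFinset_iff σ c hc i |>.2 (Perm.mem_support.2 hci),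
        Perm.eq_cycleOf_of_mem_cycleFactorsFinset_iff σ d hd i |>.2 (Perm.mem_support.2 hdi)]
    · have hfw : f w ≠ Sum.inl i := fun h => hfz (hzw.trans h)
      rw [← (hav σ hσ z h1 hfz).1, ← (hav σ hσ w h2 hfw).1, hzw]

/-- Detaching `i` from its cycle, where `σ i = j`, unless the result is already in the family. -/
def detachCompress (i j : Fin n) (F : Finset (Perm (Fin n))) (σ : Perm (Fin n)) : Perm (Fin n) :=
  if σ i = j ∧ swap i j * σ ∉ F then swap i j * σ else σ

variable {F : Finset (Perm (Fin n))} {t : ℕ}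

theorem detachCompress_injOn : Set.InjOn (detachCompress i j F) F := by
  intro σ hσ π hπ h
  unfold detachCompress at h
  split_ifs at h with h1 h2 h2
  · exact mul_left_cancel h
  · exact absurd (h ▸ hπ) h1.2
  · exact absurd (h ▸ hσ) h2.2
  · exact h

theorem le_card_common_of_not_moved (hij : i ≠ j) (hF : IsCycleIntersecting t F) (hσF : σ ∈ F)
    (hπF : π ∈ F) (hσ : σ i = j) (hπ : ¬(π i = j ∧ swap i j * π ∉ F)) :
    t ≤ #(permCycles (swap i j * σ) ∩ permCycles π) := by
  by_cases hπi : π i = j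
  · have hmem : swap i j * π ∈ F := by
      by_contra hcon
      exact hπ ⟨hπi, hcon⟩
    have hi : (swap i j * π) i ≠ j := by rwa [swap_mul_apply_left hπi]
    have hne : σ ≠ swap i j * π := fun h => hi (h ▸ hσ)
    refine (hF σ hσF _ hmem hne).trans (card_le_card fun z hz => ?_)
    obtain ⟨h1, h2⟩ := mem_inter.1 hz
    have ha := cycleAvoids_of_mem_of_mem hij hσ hi h1 h2
    refine mem_inter.2 ⟨ha.mem_swap_mul h1, ?_⟩
    have := ha.mem_swap_mul h2
    rwa [swap_mul_swap_mul_self] at this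
  · have hne : σ ≠ π := fun h => hπi (h ▸ hσ)
    refine (hF σ hσF π hπF hne).trans (card_le_card fun z hz => ?_)
    obtain ⟨h1, h2⟩ := mem_inter.1 hz
    have ha := cycleAvoids_of_mem_of_mem hij hσ hπi h1 h2
    exact mem_inter.2 ⟨ha.mem_swap_mul h1, h2⟩

theorem IsCycleIntersecting.image_detachCompress (hij : i ≠ j) (hF : IsCycleIntersecting t F) :
    IsCycleIntersecting t (F.image (detachCompress i j F)) := by
  intro σ' hσ' π' hπ' hne
  obtain ⟨σ, hσ, rfl⟩ := mem_image.1 hσ'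
  obtain ⟨π, hπ, rfl⟩ := mem_image.1 hπ'
  have hne' : σ ≠ π := fun h => hne (h ▸ rfl)
  unfold detachCompress
  split_ifs with h1 h2 h2
  · exact (hF σ hσ π hπ hne').trans (card_common_le_card_common_swap_mul hij h1.1 h2.1)
  · exact le_card_common_of_not_moved hij hF hσ hπ h1.1 h2
  · rw [inter_comm]
    exact le_card_common_of_not_moved hij hF hπ hσ h2.1 h1
  · exact hF σ hσ π hπ hne'

theorem card_support_swap_mul_lt (hij : i ≠ j) (hσ : σ i = j) :
    #(swap i j * σ).support < #σ.support := by
  refine card_lt_card ⟨fun x hx => ?_, fun hsub => ?_⟩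
  · rw [Perm.mem_support] at hx ⊢
    intro hcon
    apply hx
    have hxi : x ≠ i := by rintro rfl; exact hij (hcon.symm.trans hσ)
    have hxj : x ≠ j := by rintro rfl; exact hij (σ.injective (hσ.trans hcon.symm))
    rw [Perm.mul_apply, hcon, swap_apply_of_ne_of_ne hxi hxj]
  · have hi : i ∈ σ.support := by
      rw [Perm.mem_support, hσ]; exact hij.symm
    exact Perm.mem_support.1 (hsub hi) (swap_mul_apply_left hσ)

/-- In a family stable under detaching points, members share at least `t` fixed points. -/
theorem le_card_common_fixed (hF : IsCycleIntersecting t F) (hn : t ≤ n)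
    (hstab : ∀ σ ∈ F, ∀ i j, i ≠ j → σ i = j → swap i j * σ ∈ F) (hπ : π ∈ F) :
    ∀ (r : ℕ) (σ : Perm (Fin n)), σ ∈ F →
      #(σ.cycleFactorsFinset ∩ π.cycleFactorsFinset) = r →
      t ≤ #{x | σ x = x ∧ π x = x} := by
  intro r
  induction r using Nat.strong_induction_on with
  | _ r ih =>
  intro σ hσ hr
  rcases (σ.cycleFactorsFinset ∩ π.cycleFactorsFinset).eq_empty_or_nonempty with he | ⟨c, hc⟩
  -- Equal members are not covered by `hF`; without nontrivial cycles they are the identity, which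
  -- has `n ≥ t` fixed points.
  · by_cases hσπ : σ = π
    · subst hσπ
      rw [inter_self, Perm.cycleFactorsFinset_eq_empty_iff] at he
      subst he
      simpa using hn
    · refine (hF σ hσ π hπ hσπ).trans ?_
      refine (card_le_card (t := ({x | σ x = x ∧ π x = x} : Finset (Fin n)).map
        ⟨Sum.inl, Sum.inl_injective⟩) fun z hz => ?_).trans (card_map _).le
      obtain ⟨h1, h2⟩ := mem_inter.1 hz
      rcases z with x | c
      · rw [inl_mem_permCycles] at h1 h2
        simp [h1, h2]
      · have : c ∈ σ.cycleFactorsFinset ∩ π.cycleFactorsFinset := by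
          simpa [permCycles] using And.intro h1 h2
        rw [he] at this
        exact absurd this (notMem_empty _)
  · obtain ⟨hcσ, hcπ⟩ := mem_inter.1 hc
    obtain ⟨hcyc, hcσ'⟩ := Perm.mem_cycleFactorsFinset_iff.1 hcσ
    have hcπ' := (Perm.mem_cycleFactorsFinset_iff.1 hcπ).2
    obtain ⟨i, hi⟩ := hcyc.nonempty_support
    have hj : c i ∈ c.support := Perm.apply_mem_support.2 hi
    have hij : i ≠ c i := (Perm.mem_support.1 hi).symm
    have hσi : σ i = c i := (hcσ' i hi).symm
    have hmem := hstab σ hσ i (c i) hij hσi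
    have hc' : c ∉ (swap i (c i) * σ).cycleFactorsFinset := by
      intro hcon
      have := (Perm.mem_cycleFactorsFinset_iff.1 hcon).2 i hi
      rw [swap_mul_apply_left hσi] at this
      exact hij this.symm
    have hlt : #((swap i (c i) * σ).cycleFactorsFinset ∩ π.cycleFactorsFinset) < r := by
      rw [← hr]
      refine card_lt_card ⟨fun d hd => ?_, fun hsub => hc' (mem_inter.1 (hsub hc)).1⟩
      obtain ⟨hd1, hd2⟩ := mem_inter.1 hd
      refine mem_inter.2 ⟨?_, hd2⟩
      have hne : d ≠ c := by rintro rfl; exact hc' hd1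
      have hdis : d.Disjoint c := Perm.cycleFactorsFinset_pairwise_disjoint π hd2 hcπ hne
      have ha : CycleAvoids i (c i) (Sum.inr d) :=
        ⟨(hdis i).resolve_right (Perm.mem_support.1 hi),
          (hdis (c i)).resolve_right (Perm.mem_support.1 hj)⟩
      have h1 : Sum.inr d ∈ permCycles (swap i (c i) * σ) := by simpa [permCycles] using hd1
      have h2 := ha.mem_swap_mul h1
      rw [swap_mul_swap_mul_self] at h2
      simpa [permCycles] using h2
    -- The detached point `i` is no new common fixed point, since `π` still moves the points of `c`.
    refine (ih _ hlt _ hmem rfl).trans (card_le_card fun x hx => ?_)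
    simp only [mem_filter, mem_univ, true_and] at hx ⊢
    refine ⟨?_, hx.2⟩
    have hxs : x ∉ c.support := fun h => Perm.mem_support.1 h ((hcπ' x h).trans hx.2)
    have hxi : x ≠ i := by rintro rfl; exact hxs hi
    have hxj : x ≠ c i := by rintro rfl; exact hxs hj
    have h1 := congrArg (swap i (c i)) hx.1
    rwa [Perm.mul_apply, swap_apply_self, swap_apply_of_ne_of_ne hxi hxj] at h1

end cycles

/-! ### Stabilizers, the equality case and the final induction. -/

section stabilizers

open Finset Equiv

variable {n t : ℕ} {i j : Fin n} {F : Finset (Perm (Fin n))}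

theorem card_perm_fixing (T : Finset (Fin n)) :
    #{σ : Perm (Fin n) | ∀ i ∈ T, σ i = i} = (n - #T).factorial := by
  classical
  have h := Fintype.card_congr (Perm.subtypeEquivSubtypePerm fun a : Fin n => a ∉ T)
  simp only [not_not] at h
  rw [← Fintype.card_subtype, ← h, Fintype.card_perm]
  congr 1
  simp [Fintype.card_subtype_compl]

theorem card_perm_fixed_eq (S : Finset (Fin n)) :
    #{σ : Perm (Fin n) | ∀ x, σ x = x ↔ x ∈ S} = numDerangements (n - #S) := by
  classical
  have h := Fintype.card_congr (derangements.subtypeEquiv fun a : Fin n => a ∉ S)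
  rw [card_derangements_eq_numDerangements, Fintype.card_subtype_compl, Fintype.card_fin,
    Fintype.card_coe] at h
  rw [h, Fintype.card_subtype]
  congr 1
  ext σ
  simp only [mem_filter, mem_univ, true_and, not_not, Function.mem_fixedPoints,
    Function.IsFixedPt]
  exact forall_congr' fun x => Iff.comm

/-- Supplies a member of the stabilizer of `T` whose only cycles are the points of `T` and one long
cycle, so that it has few cycles in common with others. -/
theorem exists_isCycle_fixed_iff {T : Finset (Fin n)} (hT : #T + 2 ≤ n) :
    ∃ c : Perm (Fin n), c.IsCycle ∧ ∀ x, c x = x ↔ x ∈ T := by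
  classical
  obtain ⟨c, hc, hsupp⟩ := (Tᶜ).exists_cycleOn
  have hcard : 1 < #Tᶜ := by rw [card_compl, Fintype.card_fin]; omega
  have hnt : ((Tᶜ : Finset (Fin n)) : Set (Fin n)).Nontrivial := one_lt_card_iff_nontrivial.1 hcard
  have hfix : ∀ x, c x = x ↔ x ∈ T := by
    intro x
    constructor
    · intro hx
      by_contra hxT
      exact hc.apply_ne hnt (mem_coe.2 (mem_compl.2 hxT)) hx
    · intro hxT
      by_contra hx
      exact mem_compl.1 (hsupp (Perm.mem_support.2 hx)) hxT
  refine ⟨c, ?_, hfix⟩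
  obtain ⟨x, hx⟩ := hnt.nonempty
  refine ⟨x, hc.apply_ne hnt hx, fun y hy => hc.2 hx ?_⟩
  rw [mem_coe, mem_compl, ← hfix]
  exact hy

theorem card_common_lt {T : Finset (Fin n)} (hT : #T = t) (hij : i ≠ j) (hor : i ∈ T ∨ j ∈ T)
    (w : Fin n ⊕ Perm (Fin n)) (U : Finset (Fin n ⊕ Perm (Fin n)))
    (hU : ∀ z ∈ U, (∃ x ∈ T, x ≠ i ∧ x ≠ j ∧ z = Sum.inl x) ∨ (z = w ∧ i ∈ T ∧ j ∈ T)) :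
    #U < t := by
  classical
  have hmap : #(((T.erase i).erase j).image (Sum.inl : Fin n → Fin n ⊕ Perm (Fin n))) ≤
    #((T.erase i).erase j) := card_image_le
  by_cases hboth : i ∈ T ∧ j ∈ T
  · have h1 := card_erase_add_one hboth.1
    have h2 := card_erase_add_one (mem_erase.2 ⟨hij.symm, hboth.2⟩)
    have h3 : U ⊆ insert w (((T.erase i).erase j).image Sum.inl) := by
      intro z hz
      rcases hU z hz with ⟨x, hx, hxi, hxj, rfl⟩ | ⟨rfl, _⟩
      · exact mem_insert_of_mem (mem_image_of_mem _ (by simp [hx, hxi, hxj]))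
      · exact mem_insert_self _ _
    have h4 := (card_le_card h3).trans (card_insert_le _ _)
    omega
  · have h1 : #((T.erase i).erase j) < #T := by
      refine card_lt_card ⟨(erase_subset _ _).trans (erase_subset _ _), fun hsub => ?_⟩
      rcases hor with h | h
      · simpa using hsub h
      · simpa using hsub h
    have h3 : U ⊆ ((T.erase i).erase j).image Sum.inl := by
      intro z hz
      rcases hU z hz with ⟨x, hx, hxi, hxj, rfl⟩ | ⟨_, h⟩
      · exact mem_image_of_mem _ (by simp [hx, hxi, hxj])
      · exact absurd h hboth
    have h4 := card_le_card h3
    omega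

theorem mem_or_of_mem_image_detachCompress {σ : Perm (Fin n)}
    (h : σ ∈ F.image (detachCompress i j F)) :
    σ ∈ F ∨ (swap i j * σ ∈ F ∧ (swap i j * σ) i = j ∧ σ ∉ F) := by
  obtain ⟨ρ, hρ, rfl⟩ := mem_image.1 h
  unfold detachCompress
  split_ifs with h1
  · right
    rw [swap_mul_swap_mul_self]
    exact ⟨hρ, h1.1, h1.2⟩
  · exact Or.inl hρ

/-- If detaching points turns the family into a stabilizer, it was a stabilizer before. -/
theorem IsStabilizerOfPoints.of_image_detachCompress (hn : t + 2 ≤ n) (hij : i ≠ j)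
    (hF : IsCycleIntersecting t F)
    (hS : IsStabilizerOfPoints t (F.image (detachCompress i j F))) :
    IsStabilizerOfPoints t F := by
  classical
  obtain ⟨T, hT, hmem⟩ := hS
  by_cases hmoved : ∃ ρ ∈ F, ρ i = j ∧ swap i j * ρ ∉ F
  swap
  · refine ⟨T, hT, fun σ => ?_⟩
    rw [← hmem σ]
    push Not at hmoved
    have himg : F.image (detachCompress i j F) = F := by
      conv_rhs => rw [← image_id (s := F)]
      refine image_congr fun σ hσ => ?_
      unfold detachCompress
      rw [if_neg fun h => h.2 (hmoved σ hσ h.1), id]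
    rw [himg]
  exfalso
  obtain ⟨ρ, hρF, hρ, hρn⟩ := hmoved
  have hσ : ∀ x ∈ T, (swap i j * ρ) x = x := by
    refine (hmem _).1 (mem_image.2 ⟨ρ, hρF, ?_⟩)
    unfold detachCompress
    rw [if_pos ⟨hρ, hρn⟩]
  -- Otherwise `ρ` fixes `T` as well and so lies in the compressed family, although it was moved and
  -- its detached form was not in `F`.
  have hor : i ∈ T ∨ j ∈ T := by
    by_contra! hnot
    have hρS : ρ ∈ F.image (detachCompress i j F) := by
      refine (hmem ρ).2 fun x hx => ?_
      have hxi : x ≠ i := by rintro rfl; exact hnot.1 hx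
      have hxj : x ≠ j := by rintro rfl; exact hnot.2 hx
      have h1 := congrArg (swap i j) (hσ x hx)
      rwa [Perm.mul_apply, swap_apply_self, swap_apply_of_ne_of_ne hxi hxj] at h1
    obtain ⟨α, hα, hαρ⟩ := mem_image.1 hρS
    unfold detachCompress at hαρ
    split_ifs at hαρ with h
    · have : α = swap i j * ρ := by rw [← hαρ, swap_mul_swap_mul_self]
      exact hρn (this ▸ hα)
    · subst hαρ
      exact h ⟨hρ, hρn⟩
  obtain ⟨c, hc, hcT⟩ := exists_isCycle_fixed_iff (T := T) (by omega)
  have hcS := (hmem c).2 fun x hx => (hcT x).2 hx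
  have hfactor : ∀ (b d : Perm (Fin n)), b.IsCycle → Sum.inr d ∈ permCycles b → d = b := by
    intro b d hb hd
    have : d ∈ b.cycleFactorsFinset := by simpa [permCycles] using hd
    rw [hb.cycleFactorsFinset_eq_singleton] at this
    exact mem_singleton.1 this
  rcases mem_or_of_mem_image_detachCompress hcS with hcF | ⟨hτF, hτi, hcF⟩
  · have hcij : c i ≠ j := by
      intro hcon
      rcases hor with h | h
      · exact hij (((hcT i).2 h).symm.trans hcon)
      · exact hij (c.injective (hcon.trans ((hcT j).2 h).symm))
    have hne : ρ ≠ c := by rintro rfl; exact hcij hρ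
    refine absurd (hF ρ hρF c hcF hne) (not_le.2 (card_common_lt hT hij hor (Sum.inr c) _ ?_))
    intro z hz
    obtain ⟨h1, h2⟩ := mem_inter.1 hz
    have ha := cycleAvoids_of_mem_of_mem hij hρ hcij h1 h2
    rcases z with x | d
    · exact Or.inl ⟨x, (hcT x).1 (inl_mem_permCycles.1 h2), ha.1, ha.2, rfl⟩
    · obtain rfl := hfactor c d hc h2
      exact Or.inr ⟨rfl, (hcT i).1 ha.1, (hcT j).1 ha.2⟩
  -- Now `swap i j * c` lies in `F`. It is compared with `1` or `swap i j`, one of which is in `F`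
  -- because `1` is in the compressed family.
  · have havoid : ∀ x : Fin n, Sum.inl x ∈ permCycles (swap i j * c) →
        ∃ y ∈ T, y ≠ i ∧ y ≠ j ∧ (Sum.inl x : Fin n ⊕ Perm (Fin n)) = Sum.inl y := by
      intro x hx
      have ha := cycleAvoids_of_mem hij hτi hx (by simp)
      have h1 := ha.mem_swap_mul hx
      rw [swap_mul_swap_mul_self] at h1
      exact ⟨x, (hcT x).1 (inl_mem_permCycles.1 h1), ha.1, ha.2, rfl⟩
    rcases mem_or_of_mem_image_detachCompress ((hmem 1).2 fun x _ => rfl) with h1F | ⟨hsF, _, _⟩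
    · have hne : swap i j * c ≠ 1 := by
        intro hcon
        rw [hcon] at hτi
        exact hij hτi
      refine absurd (hF _ hτF 1 h1F hne) (not_le.2 (card_common_lt hT hij hor (Sum.inr c) _ ?_))
      intro z hz
      obtain ⟨h1, h2⟩ := mem_inter.1 hz
      rcases z with x | d
      · exact Or.inl (havoid x h1)
      · simp [permCycles] at h2
    · rw [mul_one] at hsF
      have hne : swap i j * c ≠ swap i j := by
        intro hcon
        exact hc.ne_one (mul_left_cancel (hcon.trans (mul_one _).symm))
      have hiT : c i = i := by
        have := congrArg (swap i j) hτi
        rwa [Perm.mul_apply, swap_apply_self, swap_apply_right] at this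
      refine absurd (hF _ hτF _ hsF hne)
        (not_le.2 (card_common_lt hT hij hor (Sum.inr (swap i j)) _ ?_))
      intro z hz
      obtain ⟨h1, h2⟩ := mem_inter.1 hz
      rcases z with x | d
      · exact Or.inl (havoid x h1)
      · obtain rfl := hfactor _ d (Perm.IsSwap.isCycle ⟨i, j, hij, rfl⟩) h2
        have h3 := (inr_mem_permCycles.1 h1).2 j (by rw [swap_apply_right]; exact hij)
        rw [Perm.mul_apply] at h3
        exact Or.inr ⟨rfl, (hcT i).1 hiT, (hcT j).1 ((swap i j).injective h3).symm⟩

/-- The fixed points of a permutation, as a set of natural numbers. -/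
def fixedSet (σ : Perm (Fin n)) : Finset ℕ :=
  ({x | σ x = x} : Finset (Fin n)).map Fin.valEmbedding

theorem card_fixedSet_inter (σ π : Perm (Fin n)) :
    #(fixedSet σ ∩ fixedSet π) = #{x | σ x = x ∧ π x = x} := by
  rw [fixedSet, fixedSet, ← map_inter, card_map, ← filter_and]

theorem card_le_sum_numDerangements (F : Finset (Perm (Fin n))) :
    #F ≤ ∑ A ∈ F.image fixedSet, partialDerangements 0 (n - #A) := by
  classical
  rw [card_eq_sum_card_image fixedSet F]
  refine sum_le_sum fun A hA => ?_
  obtain ⟨σ, _, rfl⟩ := mem_image.1 hA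
  have h := card_perm_fixed_eq ({x | σ x = x} : Finset (Fin n))
  rw [partialDerangements_zero, fixedSet, card_map, ← h]
  refine card_le_card fun π hπ => ?_
  have h1 := map_injective _ (mem_filter.1 hπ).2
  refine mem_filter.2 ⟨mem_univ _, fun x => ?_⟩
  rw [← h1]
  simp

theorem card_le_of_stable (ht : 1 ≤ t) (hn : 2 * t + 1 ≤ n) (hF : IsCycleIntersecting t F)
    (hstab : ∀ σ ∈ F, ∀ i j, i ≠ j → σ i = j → swap i j * σ ∈ F) :
    #F ≤ (n - t).factorial ∧ (#F = (n - t).factorial → IsStabilizerOfPoints t F) := by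
  classical
  have hfix : ∀ σ ∈ F, ∀ π ∈ F, t ≤ #{x | σ x = x ∧ π x = x} := fun σ hσ π hπ =>
    le_card_common_fixed hF (by omega) hstab hπ _ σ hσ rfl
  by_cases hex : ∃ σ ∈ F, #({x | σ x = x} : Finset (Fin n)) = t
  · obtain ⟨σ, hσ, hσt⟩ := hex
    set T : Finset (Fin n) := {x | σ x = x} with hTdef
    have hsub : F ⊆ ({π | ∀ i ∈ T, π i = i} : Finset (Perm (Fin n))) := by
      intro π hπ
      have h1 := hfix σ hσ π hπ
      rw [filter_and, ← hσt] at h1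
      have h2 := subset_of_card_le_inter h1
      refine mem_filter.2 ⟨mem_univ _, fun i hi => ?_⟩
      simpa using h2 hi
    have hcard := card_perm_fixing T
    rw [hσt] at hcard
    refine ⟨(card_le_card hsub).trans hcard.le, fun heq => ⟨T, hσt, fun π => ?_⟩⟩
    rw [eq_of_subset_of_card_le hsub (by rw [hcard, heq])]
    simp
  · push Not at hex
    have hlt := sum_partialDerangements_lt ht n 0 (by omega) (F.image fixedSet) ?_ ?_ ?_
    · rw [zero_add] at hlt
      have := (card_le_sum_numDerangements F).trans_lt hlt
      exact ⟨this.le, fun h => absurd h this.ne⟩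
    · intro A hA B hB
      obtain ⟨σ, hσ, rfl⟩ := mem_image.1 hA
      obtain ⟨π, hπ, rfl⟩ := mem_image.1 hB
      rw [card_fixedSet_inter]
      exact hfix σ hσ π hπ
    · intro A hA a ha
      obtain ⟨σ, _, rfl⟩ := mem_image.1 hA
      obtain ⟨x, _, rfl⟩ := mem_map.1 ha
      exact mem_range.2 x.2
    · intro A hA
      obtain ⟨σ, hσ, rfl⟩ := mem_image.1 hA
      rw [fixedSet, card_map]
      exact hex σ hσ

/-- Induction on the total support size, which drops whenever a compression moves some member. -/
theorem card_le_and_isStabilizer (ht : 1 ≤ t) (hn : 2 * t + 1 ≤ n) (r : ℕ) :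
    ∀ F : Finset (Perm (Fin n)), ∑ σ ∈ F, #σ.support = r → IsCycleIntersecting t F →
      #F ≤ (n - t).factorial ∧ (#F = (n - t).factorial → IsStabilizerOfPoints t F) := by
  classical
  induction r using Nat.strong_induction_on with
  | _ r ih =>
  intro F hr hF
  by_cases hstab : ∀ σ ∈ F, ∀ i j, i ≠ j → σ i = j → swap i j * σ ∈ F
  · exact card_le_of_stable ht hn hF hstab
  · push Not at hstab
    obtain ⟨σ, hσ, i, j, hij, hσi, hnot⟩ := hstab
    have hinj : Set.InjOn (detachCompress i j F) F := detachCompress_injOn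
    have hlt : ∑ π ∈ F.image (detachCompress i j F), #π.support < r := by
      rw [sum_image hinj, ← hr]
      refine sum_lt_sum (fun π _ => ?_) ⟨σ, hσ, ?_⟩
      · unfold detachCompress
        split_ifs with h
        · exact (card_support_swap_mul_lt hij h.1).le
        · exact le_rfl
      · unfold detachCompress
        rw [if_pos ⟨hσi, hnot⟩]
        exact card_support_swap_mul_lt hij hσi
    obtain ⟨h1, h2⟩ := ih _ hlt _ rfl (hF.image_detachCompress hij)
    rw [card_image_of_injOn hinj] at h1 h2
    exact ⟨h1, fun h => (h2 h).of_image_detachCompress (by omega) hij hF⟩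

end stabilizers

theorem theorem1p4 (n t : ℕ) (F : Finset (Equiv.Perm (Fin n)))
    (hF : IsCycleIntersecting t F) (hn : 2 * t + 1 ≤ n) :
    F.card ≤ (n - t).factorial ∧
      (F.card = (n - t).factorial ↔ IsStabilizerOfPoints t F) := by
  have hcard : IsStabilizerOfPoints t F → F.card = (n - t).factorial := by
    rintro ⟨T, hT, hmem⟩
    rw [← hT, ← card_perm_fixing T]
    congr 1
    ext σ
    simp [hmem]
  rcases Nat.eq_zero_or_pos t with rfl | ht
  · have huniv : Fintype.card (Equiv.Perm (Fin n)) = n.factorial := by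
      rw [Fintype.card_perm, Fintype.card_fin]
    refine ⟨(Finset.card_le_univ F).trans huniv.le, fun h => ⟨∅, rfl, fun σ => ?_⟩, hcard⟩
    rw [Finset.eq_univ_of_card F (h.trans huniv.symm)]
    simp
  · obtain ⟨h1, h2⟩ := card_le_and_isStabilizer ht hn _ F rfl hF
    exact ⟨h1, h2, hcard⟩
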